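/- All Hilbert spaces are finite-dimensional and nonzero. A channel is a completely positive, trace preserving linear map between (full) complex matrix algebras. A channel $\Phi$ is called entanglement breaking if it has the form $\Phi(\rho)=\sum_{k=1}^K R_k\,\mathrm{Tr}(X_k\rho)$, where each $R_k$ is a density matrix (positive semidefinite with trace one) and $\{X_k\}$ is a POVM, i.e. $X_k\ge 0$ and $\sum_k X_k=I$. Let $S(\rho)=-\mathrm{Tr}\,\rho\log\rho$ denote the von Neumann entropy, and define the Holevo capacity of a channel $\Omega$ by $$\chi^*(\Omega)=\sup_{\{p_k,\rho_k\}}\Big[S\Big(\Omega\Big(\sum_k p_k\rho_k\Big)\Big)-\sum_k p_k\,S(\Omega(\rho_k))\Big],$$ where the supremum runs over all finite ensembles of input states: density matrices $\rho_k$ with probabilities $p_k\ge 0$, $\sum_k p_k=1$. Theorem. If $\Phi$ is an entanglement breaking channel and $\Omega$ is an arbitrary channel, then the Holevo capacity is additive: $$\chi^*(\Phi\otimes\Omega)=\chi^*(\Phi)+\chi^*(\Omega).$$ -/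

import Mathlib

open scoped Matrix Kronecker ComplexOrder

noncomputable section

namespace Quantum

/-- A density matrix: positive semidefinite of trace one. -/
structure IsDensityMatrix {n : Type*} [Fintype n] (ρ : Matrix n n ℂ) : Prop where
  posSemidef : ρ.PosSemidef
  trace_eq_one : ρ.trace = 1

/-- The von Neumann entropy `S(ρ) = -Tr ρ log ρ = -∑ λᵢ log λᵢ` (natural logarithm, `0 log 0 = 0`),
the sum being over the eigenvalues of the Hermitian matrix `ρ`. It is only used for density
matrices; the value `0` for non-Hermitian matrices is a convention. -/
def vonNeumannEntropy {n : Type*} [Fintype n] [DecidableEq n] (ρ : Matrix n n ℂ) : ℝ :=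
  open Classical in
  if h : ρ.IsHermitian then ∑ i, Real.negMulLog (h.eigenvalues i) else 0

/-- The amplification `id ⊗ Φ` of a linear map `Φ` on matrices: `Φ` is applied to every block of a
block matrix whose blocks are indexed by `ι`. -/
def amplification (ι : Type*) {m n : Type*} (Φ : Matrix m m ℂ →ₗ[ℂ] Matrix n n ℂ)
    (M : Matrix (ι × m) (ι × m) ℂ) : Matrix (ι × n) (ι × n) ℂ :=
  Matrix.of fun p q => Φ (Matrix.of fun x y => M (p.1, x) (q.1, y)) p.2 q.2

/-- A quantum channel: a completely positive, trace preserving linear map. -/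
structure IsChannel {m n : Type*} [Fintype m] [Fintype n]
    (Φ : Matrix m m ℂ →ₗ[ℂ] Matrix n n ℂ) : Prop where
  completelyPositive : ∀ (k : ℕ) (M : Matrix (Fin k × m) (Fin k × m) ℂ),
    M.PosSemidef → (amplification (Fin k) Φ M).PosSemidef
  trace_map : ∀ A : Matrix m m ℂ, (Φ A).trace = A.trace

/-- An entanglement breaking channel: a map `Φ(ρ) = ∑ₖ Rₖ Tr(Xₖ ρ)` where every `Rₖ` is a density
matrix and `{Xₖ}` is a POVM, i.e. `Xₖ ≥ 0` and `∑ₖ Xₖ = I`. -/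
def IsEntanglementBreaking {m n : Type*} [Fintype m] [DecidableEq m] [Fintype n]
    (Φ : Matrix m m ℂ →ₗ[ℂ] Matrix n n ℂ) : Prop :=
  ∃ (K : ℕ) (R : Fin K → Matrix n n ℂ) (X : Fin K → Matrix m m ℂ),
    (∀ k, IsDensityMatrix (R k)) ∧ (∀ k, (X k).PosSemidef) ∧ ∑ k, X k = 1 ∧
    ∀ ρ : Matrix m m ℂ, Φ ρ = ∑ k, (X k * ρ).trace • R k

/-- The tensor product `Φ ⊗ Ω` of two linear maps on matrices: `Ω` acts on the second tensor factor
and `Φ` on the first one. It is the linear map with `(Φ ⊗ Ω)(A ⊗ B) = Φ(A) ⊗ Ω(B)`,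
see `tensorMap_kronecker` and `tensorMap_unique`. -/
def tensorMap {m n m' n' : Type*} (Φ : Matrix m m ℂ →ₗ[ℂ] Matrix n n ℂ)
    (Ω : Matrix m' m' ℂ →ₗ[ℂ] Matrix n' n' ℂ) :
    Matrix (m × m') (m × m') ℂ →ₗ[ℂ] Matrix (n × n') (n × n') ℂ where
  toFun A := Matrix.of fun p q =>
    Φ (Matrix.of fun i j => Ω (Matrix.of fun k l => A (i, k) (j, l)) p.2 q.2) p.1 q.1
  map_add' A B := by
    ext p q
    change Φ (Matrix.of fun i j => Ω ((Matrix.of fun k l => A (i, k) (j, l)) +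
      Matrix.of fun k l => B (i, k) (j, l)) p.2 q.2) p.1 q.1 = _
    simp only [map_add, Matrix.add_apply]
    exact congrFun (congrFun (Φ.map_add (Matrix.of fun i j => Ω _ p.2 q.2)
      (Matrix.of fun i j => Ω _ p.2 q.2)) p.1) q.1
  map_smul' c A := by
    ext p q
    change Φ (Matrix.of fun i j =>
      Ω (c • (Matrix.of fun k l => A (i, k) (j, l))) p.2 q.2) p.1 q.1 = _
    simp only [map_smul, Matrix.smul_apply]
    exact congrFun (congrFun (Φ.map_smul c (Matrix.of fun i j => Ω _ p.2 q.2)) p.1) q.1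

/-- The set of Holevo quantities `S(Ω(∑ₖ pₖ ρₖ)) - ∑ₖ pₖ S(Ω(ρₖ))` over all finite ensembles
`{pₖ, ρₖ}` of input states. -/
def holevoQuantities {m n : Type*} [Fintype m] [Fintype n] [DecidableEq n]
    (Ω : Matrix m m ℂ →ₗ[ℂ] Matrix n n ℂ) : Set ℝ :=
  {x | ∃ (K : ℕ) (p : Fin K → ℝ) (ρ : Fin K → Matrix m m ℂ),
    (∀ k, 0 ≤ p k) ∧ ∑ k, p k = 1 ∧ (∀ k, IsDensityMatrix (ρ k)) ∧
    x = vonNeumannEntropy (Ω (∑ k, (p k : ℂ) • ρ k)) - ∑ k, p k * vonNeumannEntropy (Ω (ρ k))}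

/-- The Holevo capacity `χ*(Ω)`, the supremum of the Holevo quantities. For a channel with a
nonzero input space this is a supremum of a nonempty set that is bounded above, see
`holevoQuantities_nonempty` and `holevoQuantities_bddAbove`. -/
def holevoCapacity {m n : Type*} [Fintype m] [Fintype n] [DecidableEq n]
    (Ω : Matrix m m ℂ →ₗ[ℂ] Matrix n n ℂ) : ℝ :=
  sSup (holevoQuantities Ω)

/-! ### Well-definedness of the notions above -/

theorem tensorMap_kronecker {m n m' n' : Type*} (Φ : Matrix m m ℂ →ₗ[ℂ] Matrix n n ℂ)
    (Ω : Matrix m' m' ℂ →ₗ[ℂ] Matrix n' n' ℂ) (A : Matrix m m ℂ) (B : Matrix m' m' ℂ) :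
    tensorMap Φ Ω (A ⊗ₖ B) = Φ A ⊗ₖ Ω B := by
  ext p q
  have h : (Matrix.of fun i j => A i j * Ω B p.2 q.2) = Ω B p.2 q.2 • A := by
    ext i j
    simp [mul_comm]
  change Φ (Matrix.of fun i j => Ω (A i j • B) p.2 q.2) p.1 q.1 = _
  simp only [map_smul, Matrix.smul_apply, smul_eq_mul, h, Matrix.kroneckerMap_apply, mul_comm]

theorem tensorMap_unique {m n m' n' : Type*} [Fintype m] [DecidableEq m] [Fintype m']
    [DecidableEq m'] (Φ : Matrix m m ℂ →ₗ[ℂ] Matrix n n ℂ)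
    (Ω : Matrix m' m' ℂ →ₗ[ℂ] Matrix n' n' ℂ)
    (T : Matrix (m × m') (m × m') ℂ →ₗ[ℂ] Matrix (n × n') (n × n') ℂ)
    (hT : ∀ A B, T (A ⊗ₖ B) = Φ A ⊗ₖ Ω B) : T = tensorMap Φ Ω := by
  apply LinearMap.ext
  intro A
  rw [Matrix.matrix_eq_sum_single A]
  simp only [map_sum]
  refine Finset.sum_congr rfl fun p _ => Finset.sum_congr rfl fun q _ => ?_
  have h : Matrix.single p q (A p q) =
      Matrix.single p.1 q.1 (A p q) ⊗ₖ Matrix.single p.2 q.2 (1 : ℂ) := by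
    rw [Matrix.single_kronecker_single, mul_one]
  rw [h, hT, tensorMap_kronecker]

theorem IsChannel.amplification_posSemidef {m n ι : Type*} [Fintype m] [Fintype n] [Fintype ι]
    {Φ : Matrix m m ℂ →ₗ[ℂ] Matrix n n ℂ} (hΦ : IsChannel Φ)
    {M : Matrix (ι × m) (ι × m) ℂ} (hM : M.PosSemidef) : (amplification ι Φ M).PosSemidef := by
  let e := Fintype.equivFin ι
  have h := hΦ.completelyPositive (Fintype.card ι) _
    (hM.submatrix (fun p : Fin (Fintype.card ι) × m => (e.symm p.1, p.2)))
  have h' := h.submatrix (fun p : ι × n => (e p.1, p.2))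
  convert h' using 1
  ext p q
  simp [amplification]

theorem IsChannel.map_posSemidef {m n : Type*} [Fintype m] [Fintype n]
    {Φ : Matrix m m ℂ →ₗ[ℂ] Matrix n n ℂ} (hΦ : IsChannel Φ)
    {A : Matrix m m ℂ} (hA : A.PosSemidef) : (Φ A).PosSemidef :=
  (hΦ.amplification_posSemidef (ι := Unit) (hA.submatrix Prod.snd)).submatrix (fun x => ((), x))

theorem IsChannel.map_isDensityMatrix {m n : Type*} [Fintype m] [Fintype n]
    {Φ : Matrix m m ℂ →ₗ[ℂ] Matrix n n ℂ} (hΦ : IsChannel Φ)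
    {ρ : Matrix m m ℂ} (hρ : IsDensityMatrix ρ) : IsDensityMatrix (Φ ρ) :=
  ⟨hΦ.map_posSemidef hρ.posSemidef, by rw [hΦ.trace_map, hρ.trace_eq_one]⟩

theorem IsChannel.tensorMap {m n m' n' : Type*} [Fintype m] [Fintype n] [Fintype m'] [Fintype n']
    {Φ : Matrix m m ℂ →ₗ[ℂ] Matrix n n ℂ} {Ω : Matrix m' m' ℂ →ₗ[ℂ] Matrix n' n' ℂ}
    (hΦ : IsChannel Φ) (hΩ : IsChannel Ω) : IsChannel (tensorMap Φ Ω) where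
  completelyPositive k M hM := by
    have h1 := hΩ.amplification_posSemidef
      (hM.submatrix (fun p : (Fin k × m) × m' => (p.1.1, p.1.2, p.2)))
    have h2 := hΦ.amplification_posSemidef
      (h1.submatrix (fun p : (Fin k × n') × m => ((p.1.1, p.2), p.1.2)))
    exact h2.submatrix (fun p : Fin k × n × n' => ((p.1, p.2.2), p.2.1))
  trace_map A := by
    have h1 : ∀ x : n', ∑ a, Φ (Matrix.of fun i j =>
        Ω (Matrix.of fun k l => A (i, k) (j, l)) x x) a a =
        ∑ i, Ω (Matrix.of fun k l => A (i, k) (i, l)) x x := fun x => hΦ.trace_map _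
    have h2 : ∀ i : m, ∑ x, Ω (Matrix.of fun k l => A (i, k) (i, l)) x x =
        ∑ k, A (i, k) (i, k) := fun i => hΩ.trace_map _
    calc (Quantum.tensorMap Φ Ω A).trace
        = ∑ p : n × n', Φ (Matrix.of fun i j =>
            Ω (Matrix.of fun k l => A (i, k) (j, l)) p.2 p.2) p.1 p.1 := rfl
      _ = ∑ x : n', ∑ a : n, Φ (Matrix.of fun i j =>
            Ω (Matrix.of fun k l => A (i, k) (j, l)) x x) a a := Fintype.sum_prod_type_right _
      _ = ∑ i, ∑ x, Ω (Matrix.of fun k l => A (i, k) (i, l)) x x := by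
          rw [Finset.sum_comm (s := (Finset.univ : Finset m))]
          exact Finset.sum_congr rfl fun x _ => h1 x
      _ = ∑ i, ∑ k, A (i, k) (i, k) := Finset.sum_congr rfl fun i _ => h2 i
      _ = A.trace := (Fintype.sum_prod_type fun p : m × m' => A p p).symm

theorem vonNeumannEntropy_nonneg {n : Type*} [Fintype n] [DecidableEq n] {ρ : Matrix n n ℂ}
    (hρ : IsDensityMatrix ρ) : 0 ≤ vonNeumannEntropy ρ := by
  have hH := hρ.posSemidef.isHermitian
  rw [vonNeumannEntropy, dif_pos hH]
  have h0 : ∀ i, 0 ≤ hH.eigenvalues i := hρ.posSemidef.eigenvalues_nonneg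
  have hs : ∑ i, hH.eigenvalues i = 1 := by
    have h := hH.trace_eq_sum_eigenvalues
    rw [hρ.trace_eq_one] at h
    exact Complex.ofReal_injective (by simpa using h.symm)
  exact Finset.sum_nonneg fun i hi => Real.negMulLog_nonneg (h0 i)
    (hs ▸ Finset.single_le_sum (fun j _ => h0 j) hi)

theorem vonNeumannEntropy_le_card {n : Type*} [Fintype n] [DecidableEq n] {ρ : Matrix n n ℂ}
    (hρ : IsDensityMatrix ρ) : vonNeumannEntropy ρ ≤ Fintype.card n := by
  have hH := hρ.posSemidef.isHermitian
  rw [vonNeumannEntropy, dif_pos hH]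
  have h0 : ∀ i, 0 ≤ hH.eigenvalues i := hρ.posSemidef.eigenvalues_nonneg
  have h1 : ∀ i, Real.negMulLog (hH.eigenvalues i) ≤ 1 := fun i =>
    (Real.negMulLog_le_one_sub_self (h0 i)).trans (by linarith [h0 i])
  calc _ ≤ ∑ _i : n, (1 : ℝ) := Finset.sum_le_sum fun i _ => h1 i
    _ = _ := by simp

theorem IsDensityMatrix.sum_smul {m : Type*} [Fintype m] {K : ℕ} {p : Fin K → ℝ}
    {ρ : Fin K → Matrix m m ℂ} (hp : ∀ k, 0 ≤ p k) (hs : ∑ k, p k = 1)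
    (hρ : ∀ k, IsDensityMatrix (ρ k)) : IsDensityMatrix (∑ k, (p k : ℂ) • ρ k) where
  posSemidef := Matrix.posSemidef_sum _ fun k _ =>
    (hρ k).posSemidef.smul (by exact_mod_cast hp k)
  trace_eq_one := by
    simp only [Matrix.trace_sum, Matrix.trace_smul, (hρ _).trace_eq_one, smul_eq_mul, mul_one]
    exact_mod_cast hs

theorem holevoQuantities_nonempty {m n : Type*} [Fintype m] [Nonempty m] [Fintype n]
    [DecidableEq n] (Ω : Matrix m m ℂ →ₗ[ℂ] Matrix n n ℂ) : (holevoQuantities Ω).Nonempty := by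
  classical
  obtain ⟨i⟩ := ‹Nonempty m›
  refine ⟨_, 1, fun _ => 1, fun _ => Matrix.diagonal (Pi.single i 1), by simp, by simp,
    fun _ => ⟨?_, by simp [Matrix.trace]⟩, rfl⟩
  refine Matrix.PosSemidef.diagonal ?_
  exact Pi.single_nonneg.2 zero_le_one

theorem holevoQuantities_bddAbove {m n : Type*} [Fintype m] [Fintype n] [DecidableEq n]
    {Ω : Matrix m m ℂ →ₗ[ℂ] Matrix n n ℂ} (hΩ : IsChannel Ω) : BddAbove (holevoQuantities Ω) := by
  refine ⟨Fintype.card n, ?_⟩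
  rintro x ⟨K, p, ρ, hp, hs, hρ, rfl⟩
  have h1 := vonNeumannEntropy_le_card
    (hΩ.map_isDensityMatrix (IsDensityMatrix.sum_smul hp hs hρ))
  have h2 : 0 ≤ ∑ k, p k * vonNeumannEntropy (Ω (ρ k)) := Finset.sum_nonneg fun k _ =>
    mul_nonneg (hp k) (vonNeumannEntropy_nonneg (hΩ.map_isDensityMatrix (hρ k)))
  linarith

theorem IsEntanglementBreaking.isChannel {m n : Type*} [Fintype m] [DecidableEq m] [Fintype n]
    {Φ : Matrix m m ℂ →ₗ[ℂ] Matrix n n ℂ} (hΦ : IsEntanglementBreaking Φ) : IsChannel Φ := by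
  obtain ⟨K, R, X, hR, hX, hsum, hΦ⟩ := hΦ
  refine ⟨fun d M hM => ?_, fun A => ?_⟩
  · have h : amplification (Fin d) Φ M = ∑ k, (Matrix.of fun i j =>
        (X k * Matrix.of fun x y => M (i, x) (j, y)).trace) ⊗ₖ R k := by
      ext p q
      simp [amplification, hΦ, Matrix.sum_apply]
    rw [h]
    refine Matrix.posSemidef_sum _ fun k _ => Matrix.PosSemidef.kronecker ?_ (hR k).posSemidef
    obtain ⟨B, hB⟩ : ∃ B, X k = Bᴴ * B := by
      open scoped MatrixOrder in
      exact CStarAlgebra.nonneg_iff_eq_star_mul_self.mp (hX k).nonneg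
    have hN := hM.mul_mul_conjTranspose_same ((1 : Matrix (Fin d) (Fin d) ℂ) ⊗ₖ B)
    have h' : (Matrix.of fun i j => (X k * Matrix.of fun x y => M (i, x) (j, y)).trace) =
        ∑ a : m, (((1 : Matrix (Fin d) (Fin d) ℂ) ⊗ₖ B) * M *
          ((1 : Matrix (Fin d) (Fin d) ℂ) ⊗ₖ B)ᴴ).submatrix (fun i => (i, a)) fun i => (i, a) := by
      ext i j
      rw [Matrix.of_apply, hB, Matrix.mul_assoc, Matrix.trace_mul_comm, Matrix.sum_apply]
      refine Finset.sum_congr rfl fun a _ => ?_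
      simp [Matrix.mul_apply, Fintype.sum_prod_type, Matrix.one_apply, Finset.sum_mul]
      rw [Finset.sum_eq_single (M := ℂ) j (fun x _ hx => by simp [hx.symm]) (by simp)]
      simp
    rw [h']
    exact Matrix.posSemidef_sum _ fun a _ => hN.submatrix _
  · rw [hΦ, Matrix.trace_sum]
    simp only [Matrix.trace_smul, (hR _).trace_eq_one, smul_eq_mul, mul_one]
    rw [← Matrix.trace_sum, ← Finset.sum_mul, hsum, one_mul]

end Quantum

end

/-!
Let `Φ(ρ) = ∑ₖ Tr(Xₖ ρ) Rₖ`. Measuring the first factor of a bipartite state `ρ` with the POVM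
`{Xₖ}` leaves the second factor in a state `τₖ` with probability `tₖ`, so
`(Φ ⊗ Ω)(ρ) = ∑ₖ tₖ Rₖ ⊗ Ω(τₖ)` is separable. A separable state satisfies
`S(∑ₖ tₖ Rₖ ⊗ σₖ) ≥ S(∑ₖ tₖ Rₖ) + ∑ₖ tₖ S(σₖ)`: writing `ω` for the state and working in an
eigenbasis of `σₖ`, this is the operator concavity of the logarithm, used once for compressing
`log ω` to the diagonal blocks of `ω` and once for passing from these blocks to their sum, the
marginal of `ω`. Averaging this bound over an ensemble, and applying subadditivity of the entropy to
the average output, bounds a Holevo quantity of `Φ ⊗ Ω` by the sum of one of `Φ` (for the marginals)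
and one of `Ω` (for the `τₖ`). The reverse inequality follows from product ensembles.
-/

noncomputable section

namespace Quantum

section IsometryReflection

variable {m n : Type*} [Fintype m] [Fintype n] [DecidableEq n]

/-- The reflection in the range of an isometry `V`, as `V Vᴴ` is the projection onto that range. It
is used to pinch a matrix to the range of `V` and its complement. -/
def isometryReflection (V : Matrix n m ℂ) : Matrix n n ℂ :=
  2 * (V * Vᴴ) - 1

variable {V : Matrix n m ℂ}

theorem isHermitian_isometryReflection : (isometryReflection V).IsHermitian := by
  simp only [Matrix.IsHermitian, isometryReflection, two_mul, Matrix.conjTranspose_sub,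
    Matrix.conjTranspose_add, Matrix.conjTranspose_mul, Matrix.conjTranspose_conjTranspose,
    Matrix.conjTranspose_one]

variable [DecidableEq m]

theorem isometryReflection_mul (hV : Vᴴ * V = 1) : isometryReflection V * V = V := by
  simp only [isometryReflection, two_mul, Matrix.sub_mul, Matrix.add_mul, Matrix.mul_assoc, hV,
    Matrix.mul_one, Matrix.one_mul, add_sub_cancel_right]

theorem conjTranspose_mul_isometryReflection (hV : Vᴴ * V = 1) :
    Vᴴ * isometryReflection V = Vᴴ := by
  simpa only [Matrix.conjTranspose_mul, isHermitian_isometryReflection.eq] using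
    congrArg Matrix.conjTranspose (isometryReflection_mul hV)

theorem isometryReflection_mul_self (hV : Vᴴ * V = 1) :
    isometryReflection V * isometryReflection V = 1 := by
  nth_rw 2 [isometryReflection]
  rw [mul_sub, two_mul, mul_add, ← Matrix.mul_assoc, isometryReflection_mul hV, mul_one, ← two_mul,
    isometryReflection, sub_sub_cancel]

theorem posDef_isometryReflection_mul_mul (hV : Vᴴ * V = 1) {X : Matrix n n ℂ} (hX : X.PosDef) :
    (isometryReflection V * X * isometryReflection V).PosDef := by
  have hWW := isometryReflection_mul_self hV
  simpa only [isHermitian_isometryReflection.eq] using hX.conjTranspose_mul_mul_same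
    (Matrix.mulVec_injective_of_isUnit (IsUnit.of_mul_eq_one _ hWW))

end IsometryReflection

section FunctionalCalculus

open scoped Matrix.Norms.L2Operator MatrixOrder

variable {m n : Type*} [Fintype m] [DecidableEq m] [Fintype n] [DecidableEq n]

theorem trace_cfc {A : Matrix n n ℂ} (hA : A.IsHermitian) (f : ℝ → ℝ) :
    (cfc f A).trace = ∑ i, (f (hA.eigenvalues i) : ℂ) := by
  rw [hA.cfc_eq, Matrix.IsHermitian.cfc, Unitary.conjStarAlgAut_apply, Matrix.trace_mul_comm,
    ← mul_assoc, Unitary.coe_star_mul_self, one_mul]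
  simp only [Matrix.trace_diagonal, Function.comp_apply, Complex.coe_algebraMap]

theorem aeval_mul_eq_mul_aeval {A : Matrix n n ℂ} {B : Matrix m m ℂ} {V : Matrix n m ℂ}
    (hV : A * V = V * B) (p : Polynomial ℝ) :
    Polynomial.aeval A p * V = V * Polynomial.aeval B p := by
  induction p using Polynomial.induction_on' with
  | add p q hp hq => simp only [map_add, Matrix.add_mul, Matrix.mul_add, hp, hq]
  | monomial k a =>
    have hpow : A ^ k * V = V * B ^ k := by
      induction k with
      | zero => simp only [pow_zero, Matrix.one_mul, Matrix.mul_one]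
      | succ k ih => rw [pow_succ', pow_succ, Matrix.mul_assoc, ih, ← Matrix.mul_assoc, hV,
          Matrix.mul_assoc, ← pow_succ', pow_succ]
    simp only [Polynomial.aeval_monomial, ← Algebra.smul_def, Matrix.smul_mul, Matrix.mul_smul,
      hpow]

theorem cfc_mul_eq_mul_cfc {A : Matrix n n ℂ} {B : Matrix m m ℂ} (hA : A.IsHermitian)
    (hB : B.IsHermitian) {V : Matrix n m ℂ} (hV : A * V = V * B) (f : ℝ → ℝ) :
    cfc f A * V = V * cfc f B := by
  let s : Finset ℝ := A.finite_real_spectrum.toFinset ∪ B.finite_real_spectrum.toFinset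
  let p : Polynomial ℝ := Lagrange.interpolate s id f
  have hp : ∀ x ∈ s, f x = p.eval x := fun x hx =>
    (Lagrange.eval_interpolate_at_node f (Function.injective_id.injOn) hx).symm
  have hAp : cfc f A = Polynomial.aeval A p := by
    rw [← cfc_polynomial p A hA.isSelfAdjoint]
    exact cfc_congr fun x hx => hp x (by simp [s, hx])
  have hBp : cfc f B = Polynomial.aeval B p := by
    rw [← cfc_polynomial p B hB.isSelfAdjoint]
    exact cfc_congr fun x hx => hp x (by simp [s, hx])
  rw [hAp, hBp, aeval_mul_eq_mul_aeval hV]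

/- Averaging `X` with its conjugate by the reflection `W` in the range of `V` pinches `X` to that
range and its complement: the average `Y` satisfies `Y V = V (Vᴴ X V)`, so that `cfc f Y` restricts
to `cfc f (Vᴴ X V)` on the range of `V`. -/
theorem conjTranspose_mul_cfc_mul_le {f : ℝ → ℝ}
    (hf : ConcaveOn ℝ {A : Matrix n n ℂ | IsStrictlyPositive A} (cfc f)) {X : Matrix n n ℂ}
    (hX : X.PosDef) {V : Matrix n m ℂ} (hV : Vᴴ * V = 1) :
    Vᴴ * cfc f X * V ≤ cfc f (Vᴴ * X * V) := by
  set W := isometryReflection V with hW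
  have hWV : W * V = V := isometryReflection_mul hV
  have hVW : Vᴴ * W = Vᴴ := conjTranspose_mul_isometryReflection hV
  have hXW : (W * X * W).PosDef := posDef_isometryReflection_mul_mul hV hX
  have hcfcW : Vᴴ * cfc f (W * X * W) * V = Vᴴ * cfc f X * V := by
    have h : cfc f (W * X * W) * W = W * cfc f X := cfc_mul_eq_mul_cfc hXW.isHermitian
      hX.isHermitian (by rw [mul_assoc, isometryReflection_mul_self hV, mul_one]) f
    calc Vᴴ * cfc f (W * X * W) * V = Vᴴ * (cfc f (W * X * W) * W) * V := by
          simp only [Matrix.mul_assoc, hWV]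
      _ = Vᴴ * W * cfc f X * V := by rw [h, ← Matrix.mul_assoc]
      _ = Vᴴ * cfc f X * V := by rw [hVW]
  set Y : Matrix n n ℂ := (1 / 2 : ℝ) • X + (1 / 2 : ℝ) • (W * X * W) with hY
  have hYV : Y * V = V * (Vᴴ * X * V) := by
    rw [hY, Matrix.add_mul, Matrix.smul_mul, Matrix.smul_mul, Matrix.mul_assoc, hWV, hW,
      isometryReflection]
    simp only [two_mul, Matrix.sub_mul, Matrix.add_mul, Matrix.mul_assoc, Matrix.one_mul]
    module
  have hcfcY : Vᴴ * cfc f Y * V = cfc f (Vᴴ * X * V) := by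
    have hYH : Y.IsHermitian := (hX.isHermitian.smul (IsSelfAdjoint.all _)).add
      (hXW.isHermitian.smul (IsSelfAdjoint.all _))
    rw [Matrix.mul_assoc, cfc_mul_eq_mul_cfc hYH
      (Matrix.isHermitian_conjTranspose_mul_mul V hX.isHermitian) hYV f, ← Matrix.mul_assoc, hV,
      Matrix.one_mul]
  have hconcave : (1 / 2 : ℝ) • cfc f X + (1 / 2 : ℝ) • cfc f (W * X * W) ≤ cfc f Y :=
    hf.2 hX.isStrictlyPositive hXW.isStrictlyPositive (by norm_num) (by norm_num) (by norm_num)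
  have hconj := (Matrix.le_iff.mp hconcave).conjTranspose_mul_mul_same V
  rw [Matrix.mul_sub, Matrix.sub_mul, hcfcY, Matrix.mul_add, Matrix.add_mul, Matrix.mul_smul,
    Matrix.smul_mul, Matrix.mul_smul, Matrix.smul_mul, hcfcW, ← add_smul, add_halves,
    one_smul] at hconj
  exact Matrix.le_iff.mpr hconj

end FunctionalCalculus

theorem sum_smul_log_add_le {A ι : Type*} [CStarAlgebra A] [PartialOrder A] [StarOrderedRing A]
    [Fintype ι] {s : ι → ℝ} (hs : ∀ j, 0 ≤ s j) (hsum : ∑ j, s j = 1) {X : ι → A}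
    (hX : ∀ j, IsStrictlyPositive (X j)) :
    ∑ j, s j • CFC.log (X j) + algebraMap ℝ A (∑ j, (s j).negMulLog) ≤ CFC.log (∑ j, X j) := by
  let Y : ι → A := fun j => if s j = 0 then 1 else (s j)⁻¹ • X j
  have hY : ∀ j, IsStrictlyPositive (Y j) := fun j => by
    by_cases h : s j = 0
    · simp only [Y, h, if_true, isStrictlyPositive_one]
    · simp only [Y, h, if_false]
      exact (hX j).smul (inv_pos.2 ((hs j).lt_of_ne' h))
  have hlog : ∀ j, s j • CFC.log (Y j) =
      s j • CFC.log (X j) + algebraMap ℝ A (s j).negMulLog := fun j => by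
    by_cases h : s j = 0
    · simp [h]
    · simp only [Y, h, if_false]
      rw [CFC.log_smul' (X j) (inv_pos.2 ((hs j).lt_of_ne' h)) (hX j), Real.log_inv, smul_add,
        add_comm, Algebra.algebraMap_eq_smul_one, Algebra.algebraMap_eq_smul_one, smul_smul,
        Real.negMulLog, mul_neg, neg_mul]
  have hle : ∑ j, s j • Y j ≤ ∑ j, X j := Finset.sum_le_sum fun j _ => by
    by_cases h : s j = 0
    · simpa [Y, h] using (hX j).nonneg
    · simp [Y, h]
  have hpos : IsStrictlyPositive (∑ j, s j • Y j) :=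
    (CFC.concaveOn_log (A := A)).1.sum_mem (fun j _ => hs j) hsum fun j _ => hY j
  calc ∑ j, s j • CFC.log (X j) + algebraMap ℝ A (∑ j, (s j).negMulLog)
      = ∑ j, s j • CFC.log (Y j) := by simp only [hlog, Finset.sum_add_distrib, map_sum]
    _ ≤ CFC.log (∑ j, s j • Y j) :=
      CFC.concaveOn_log.le_map_sum (fun j _ => hs j) hsum fun j _ => hY j
    _ ≤ CFC.log (∑ j, X j) := CFC.log_le_log hle hpos

section Entropy

open scoped Matrix.Norms.L2Operator

variable {n : Type*} [Fintype n] [DecidableEq n] {A : Matrix n n ℂ}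

theorem vonNeumannEntropy_eq_sum_negMulLog (hA : A.IsHermitian) :
    vonNeumannEntropy A = ∑ i, (hA.eigenvalues i).negMulLog :=
  dif_pos hA

theorem tendsto_trace_mul_log_add_smul_one (hA : A.IsHermitian) :
    Filter.Tendsto (fun ε : ℝ => (A * CFC.log (A + ε • (1 : Matrix n n ℂ))).trace.re) (nhds 0)
      (nhds (-vonNeumannEntropy A)) := by
  have hcfc : ∀ ε : ℝ, A * CFC.log (A + ε • (1 : Matrix n n ℂ)) =
      cfc (fun x => x * Real.log (x + ε)) A := fun ε => by
    have hadd : A + ε • (1 : Matrix n n ℂ) = cfc (fun x => x + ε) A := by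
      rw [cfc_add_const _ _ _ (by fun_prop) hA.isSelfAdjoint, cfc_id' ℝ A hA.isSelfAdjoint,
        Algebra.algebraMap_eq_smul_one]
    have hcont : ∀ f : ℝ → ℝ, ContinuousOn f (spectrum ℝ A) := fun f =>
      A.finite_real_spectrum.continuousOn f
    have hcont' : ∀ f : ℝ → ℝ, ContinuousOn f ((fun x => x + ε) '' spectrum ℝ A) := fun f =>
      (A.finite_real_spectrum.image _).continuousOn f
    rw [hadd, CFC.log, ← cfc_comp' _ _ A (hcont' _) (hcont _) hA.isSelfAdjoint,
      cfc_mul (fun x => x) _ A (hcont _) (hcont _), cfc_id' ℝ A hA.isSelfAdjoint]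
  have hscalar : ∀ x : ℝ, Filter.Tendsto (fun ε => x * Real.log (x + ε)) (nhds 0)
      (nhds (-x.negMulLog)) := fun x => by
    rcases eq_or_ne x 0 with rfl | hx
    · simp
    · have h : ContinuousAt (fun ε => x * Real.log (x + ε)) 0 := by fun_prop (disch := simpa)
      simpa [Real.negMulLog] using h.tendsto
  simp only [hcfc, trace_cfc hA, vonNeumannEntropy_eq_sum_negMulLog hA, ← Finset.sum_neg_distrib,
    ← Complex.ofReal_sum, Complex.ofReal_re]
  exact tendsto_finsetSum _ fun i _ => hscalar _

end Entropy

section Peierls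

variable {n : Type*} [Fintype n] [DecidableEq n]

theorem conjTranspose_mul_diagonal_mul_apply_self (W : Matrix n n ℂ) (d : n → ℝ)
    (j : n) : (Wᴴ * Matrix.diagonal (fun i => (d i : ℂ)) * W) j j =
      ((∑ i, Complex.normSq (W i j) * d i : ℝ) : ℂ) := by
  rw [Matrix.mul_apply]
  push_cast
  refine Finset.sum_congr rfl fun i _ => ?_
  rw [Matrix.mul_diagonal, Matrix.conjTranspose_apply, Complex.normSq_eq_conj_mul_self,
    Complex.star_def, mul_right_comm]

theorem sum_normSq_col_eq_one {W : Matrix n n ℂ}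
    (hW : W ∈ Matrix.unitaryGroup n ℂ) (j : n) : ∑ i, Complex.normSq (W i j) = 1 := by
  have h := conjTranspose_mul_diagonal_mul_apply_self W (fun _ => 1) j
  simp only [Complex.ofReal_one, Matrix.diagonal_one, mul_one] at h
  rw [← Matrix.star_eq_conjTranspose, Matrix.mem_unitaryGroup_iff'.1 hW, Matrix.one_apply_eq] at h
  exact_mod_cast h.symm

theorem sum_normSq_row_eq_one {W : Matrix n n ℂ}
    (hW : W ∈ Matrix.unitaryGroup n ℂ) (i : n) : ∑ j, Complex.normSq (W i j) = 1 := by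
  simpa only [Matrix.star_apply, Complex.star_def, Complex.normSq_conj] using
    sum_normSq_col_eq_one (Unitary.star_mem hW) i

theorem sum_eigenvalues_le_sum_diag {s : Set ℝ} {f : ℝ → ℝ} (hf : ConcaveOn ℝ s f)
    {A V : Matrix n n ℂ} (hA : A.IsHermitian)
    (hs : ∀ i, hA.eigenvalues i ∈ s) (hV : V ∈ Matrix.unitaryGroup n ℂ) :
    ∑ i, f (hA.eigenvalues i) ≤ ∑ j, f ((Vᴴ * A * V) j j).re := by
  set U : Matrix n n ℂ := ↑hA.eigenvectorUnitary
  have hW : Uᴴ * V ∈ Matrix.unitaryGroup n ℂ :=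
    mul_mem (Unitary.star_mem hA.eigenvectorUnitary.2) hV
  have hdiag : ∀ j, ((Vᴴ * A * V) j j).re =
      ∑ i, Complex.normSq ((Uᴴ * V) i j) * hA.eigenvalues i := fun j => by
    have hspec : A = U * Matrix.diagonal (fun i => (hA.eigenvalues i : ℂ)) * Uᴴ := by
      conv_lhs => rw [hA.spectral_theorem, Unitary.conjStarAlgAut_apply]
      rfl
    have hconj : Vᴴ * A * V =
        (Uᴴ * V)ᴴ * Matrix.diagonal (fun i => (hA.eigenvalues i : ℂ)) * (Uᴴ * V) := by
      conv_lhs => rw [hspec]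
      simp only [Matrix.conjTranspose_mul, Matrix.conjTranspose_conjTranspose, Matrix.mul_assoc]
    rw [hconj, conjTranspose_mul_diagonal_mul_apply_self, Complex.ofReal_re]
  calc ∑ i, f (hA.eigenvalues i)
      = ∑ i, ∑ j, Complex.normSq ((Uᴴ * V) i j) * f (hA.eigenvalues i) := by
        simp only [← Finset.sum_mul, sum_normSq_row_eq_one hW, one_mul]
    _ = ∑ j, ∑ i, Complex.normSq ((Uᴴ * V) i j) • f (hA.eigenvalues i) := Finset.sum_comm
    _ ≤ ∑ j, f (∑ i, Complex.normSq ((Uᴴ * V) i j) • hA.eigenvalues i) :=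
        Finset.sum_le_sum fun j _ => hf.le_map_sum (fun i _ => Complex.normSq_nonneg _)
          (sum_normSq_col_eq_one hW j) fun i _ => hs i
    _ = ∑ j, f ((Vᴴ * A * V) j j).re := by simp only [hdiag, smul_eq_mul]

end Peierls

theorem sum_negMulLog_le_add {m n : Type*} [Fintype m] [Fintype n] {p : m × n → ℝ}
    (hp : ∀ x, 0 ≤ p x) (hsum : ∑ x, p x = 1) :
    ∑ x, (p x).negMulLog ≤
      ∑ i, (∑ j, p (i, j)).negMulLog + ∑ j, (∑ i, p (i, j)).negMulLog := by
  set a : m → ℝ := fun i => ∑ j, p (i, j)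
  let c : m → n → ℝ := fun i j => p (i, j) / a i
  have ha0 : ∀ i, 0 ≤ a i := fun i => Finset.sum_nonneg fun j _ => hp (i, j)
  have hac : ∀ i j, p (i, j) = a i * c i j := fun i j => by
    rcases eq_or_ne (a i) 0 with h | h
    · rw [h, zero_mul]
      exact (Finset.sum_eq_zero_iff_of_nonneg fun j _ => hp (i, j)).1 h j (Finset.mem_univ j)
    · exact (mul_div_cancel₀ _ h).symm
  have hc : ∀ i, (∑ j, c i j) * (a i).negMulLog = (a i).negMulLog := fun i => by
    rcases eq_or_ne (a i) 0 with h | h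
    · rw [h, Real.negMulLog_zero, mul_zero]
    · rw [← Finset.sum_div, div_self h, one_mul]
  calc ∑ x, (p x).negMulLog
      = ∑ i, ∑ j, (c i j * (a i).negMulLog + a i * (c i j).negMulLog) := by
        simp only [Fintype.sum_prod_type, hac, Real.negMulLog_mul]
    _ = ∑ i, (a i).negMulLog + ∑ j, ∑ i, a i • (c i j).negMulLog := by
        simp only [Finset.sum_add_distrib, ← Finset.sum_mul, hc, smul_eq_mul]
        rw [Finset.sum_comm (f := fun i j => a i * (c i j).negMulLog)]
    _ ≤ ∑ i, (a i).negMulLog + ∑ j, (∑ i, a i • c i j).negMulLog := by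
        gcongr with j
        exact Real.concaveOn_negMulLog.le_map_sum (fun i _ => ha0 i)
          (by rw [← hsum, Fintype.sum_prod_type]) fun i _ => div_nonneg (hp _) (ha0 i)
    _ = ∑ i, (a i).negMulLog + ∑ j, (∑ i, p (i, j)).negMulLog := by
        simp only [hac, smul_eq_mul]

section Kronecker

variable {ι l m n p α : Type*} [NonUnitalNonAssocSemiring α] (s : Finset ι)

theorem sum_kronecker (A : ι → Matrix l m α) (B : Matrix n p α) :
    (∑ k ∈ s, A k) ⊗ₖ B = ∑ k ∈ s, A k ⊗ₖ B := by
  ext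
  simp only [Matrix.kroneckerMap_apply, Matrix.sum_apply, Finset.sum_mul]

theorem kronecker_sum (A : Matrix l m α) (B : ι → Matrix n p α) :
    A ⊗ₖ (∑ k ∈ s, B k) = ∑ k ∈ s, A ⊗ₖ B k := by
  ext
  simp only [Matrix.kroneckerMap_apply, Matrix.sum_apply, Finset.mul_sum]

end Kronecker

section PartialTrace

variable {n' n : Type*}

/-- The partial trace over the second tensor factor. -/
def traceSnd [Fintype n'] : Matrix (n × n') (n × n') ℂ →ₗ[ℂ] Matrix n n ℂ where
  toFun A := ∑ k, A.submatrix (fun i => (i, k)) fun i => (i, k)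
  map_add' A B := by simp only [Matrix.submatrix_add, Pi.add_apply, Finset.sum_add_distrib]
  map_smul' c A := by
    simp only [Matrix.submatrix_smul, Pi.smul_apply, Finset.smul_sum, RingHom.id_apply]

/-- The partial trace over the first tensor factor. -/
def traceFst [Fintype n] : Matrix (n × n') (n × n') ℂ →ₗ[ℂ] Matrix n' n' ℂ :=
  traceSnd ∘ₗ
    (Matrix.reindexLinearEquiv ℂ ℂ (Equiv.prodComm n n') (Equiv.prodComm n n')).toLinearMap

theorem traceSnd_apply [Fintype n'] (A : Matrix (n × n') (n × n') ℂ) :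
    traceSnd A = ∑ k, A.submatrix (fun i => (i, k)) fun i => (i, k) := rfl

theorem traceFst_eq_traceSnd_submatrix_swap [Fintype n] (A : Matrix (n × n') (n × n') ℂ) :
    traceFst A = traceSnd (A.submatrix Prod.swap Prod.swap) := rfl

theorem submatrix_swap_kronecker (A : Matrix n n ℂ) (B : Matrix n' n' ℂ) :
    (A ⊗ₖ B).submatrix Prod.swap Prod.swap = B ⊗ₖ A := by
  ext; exact mul_comm _ _

theorem traceSnd_kronecker [Fintype n'] (A : Matrix n n ℂ) (B : Matrix n' n' ℂ) :
    traceSnd (A ⊗ₖ B) = B.trace • A := by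
  ext i j
  simp [traceSnd_apply, Matrix.sum_apply, Matrix.trace, ← Finset.mul_sum, mul_comm]

theorem traceFst_kronecker [Fintype n] (A : Matrix n n ℂ) (B : Matrix n' n' ℂ) :
    traceFst (A ⊗ₖ B) = A.trace • B := by
  rw [traceFst_eq_traceSnd_submatrix_swap, submatrix_swap_kronecker, traceSnd_kronecker]

theorem traceSnd_posSemidef [Fintype n'] {A : Matrix (n × n') (n × n') ℂ} (hA : A.PosSemidef) :
    (traceSnd A).PosSemidef :=
  Matrix.posSemidef_sum _ fun _ _ => hA.submatrix _

theorem traceFst_posSemidef [Fintype n] {A : Matrix (n × n') (n × n') ℂ} (hA : A.PosSemidef) :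
    (traceFst A).PosSemidef :=
  traceSnd_posSemidef (hA.submatrix _)

variable [Fintype n] [Fintype n']

theorem trace_traceSnd (A : Matrix (n × n') (n × n') ℂ) : (traceSnd A).trace = A.trace := by
  rw [traceSnd_apply, Matrix.trace_sum]
  exact (Fintype.sum_prod_type_right fun p => A p p).symm

theorem trace_traceFst (A : Matrix (n × n') (n × n') ℂ) : (traceFst A).trace = A.trace := by
  rw [traceFst_eq_traceSnd_submatrix_swap, trace_traceSnd]
  exact (Equiv.prodComm n' n).sum_comp fun p => A p p

theorem IsDensityMatrix.traceSnd {A : Matrix (n × n') (n × n') ℂ} (hA : IsDensityMatrix A) :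
    IsDensityMatrix (traceSnd A) :=
  ⟨traceSnd_posSemidef hA.posSemidef, by rw [trace_traceSnd, hA.trace_eq_one]⟩

theorem IsDensityMatrix.traceFst {A : Matrix (n × n') (n × n') ℂ} (hA : IsDensityMatrix A) :
    IsDensityMatrix (traceFst A) :=
  ⟨traceFst_posSemidef hA.posSemidef, by rw [trace_traceFst, hA.trace_eq_one]⟩

theorem IsDensityMatrix.kronecker {A : Matrix n n ℂ} {B : Matrix n' n' ℂ}
    (hA : IsDensityMatrix A) (hB : IsDensityMatrix B) : IsDensityMatrix (A ⊗ₖ B) :=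
  ⟨hA.posSemidef.kronecker hB.posSemidef,
    by rw [Matrix.trace_kronecker, hA.trace_eq_one, hB.trace_eq_one, one_mul]⟩

theorem traceSnd_kronecker_one_mul [DecidableEq n'] (A : Matrix n n ℂ)
    (M : Matrix (n × n') (n × n') ℂ) :
    traceSnd ((A ⊗ₖ (1 : Matrix n' n' ℂ)) * M) = A * traceSnd M := by
  rw [traceSnd_apply, traceSnd_apply, Matrix.mul_sum]
  refine Finset.sum_congr rfl fun k _ => ?_
  ext i j
  simp [Matrix.mul_apply, Fintype.sum_prod_type, Matrix.one_apply]

theorem traceSnd_mul_kronecker_one [DecidableEq n'] (A : Matrix n n ℂ)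
    (M : Matrix (n × n') (n × n') ℂ) :
    traceSnd (M * (A ⊗ₖ (1 : Matrix n' n' ℂ))) = traceSnd M * A := by
  rw [traceSnd_apply, traceSnd_apply, Matrix.sum_mul]
  refine Finset.sum_congr rfl fun k _ => ?_
  ext i j
  simp [Matrix.mul_apply, Fintype.sum_prod_type, Matrix.one_apply]

theorem traceSnd_one_kronecker_mul_comm [DecidableEq n] (B : Matrix n' n' ℂ)
    (M : Matrix (n × n') (n × n') ℂ) :
    traceSnd (((1 : Matrix n n ℂ) ⊗ₖ B) * M) = traceSnd (M * ((1 : Matrix n n ℂ) ⊗ₖ B)) := by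
  ext i j
  simp only [traceSnd_apply, Matrix.sum_apply, Matrix.submatrix_apply, Matrix.mul_apply,
    Matrix.kroneckerMap_apply, Fintype.sum_prod_type, Matrix.one_apply, ite_mul, mul_ite, one_mul,
    zero_mul, mul_zero, Finset.sum_ite_irrel, Finset.sum_const_zero, Finset.sum_ite_eq,
    Finset.sum_ite_eq', Finset.mem_univ, if_true]
  rw [Finset.sum_comm]
  simp only [mul_comm]

theorem submatrix_swap_mul (M N : Matrix (n × n') (n × n') ℂ) :
    (M * N).submatrix Prod.swap Prod.swap =
      M.submatrix Prod.swap Prod.swap * N.submatrix Prod.swap Prod.swap :=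
  (Matrix.submatrix_mul_equiv M N _ (Equiv.prodComm n' n) _).symm

theorem traceFst_kronecker_one_mul_comm [DecidableEq n'] (A : Matrix n n ℂ)
    (M : Matrix (n × n') (n × n') ℂ) :
    traceFst ((A ⊗ₖ (1 : Matrix n' n' ℂ)) * M) = traceFst (M * (A ⊗ₖ (1 : Matrix n' n' ℂ))) := by
  simp only [traceFst_eq_traceSnd_submatrix_swap, submatrix_swap_mul, submatrix_swap_kronecker,
    traceSnd_one_kronecker_mul_comm]

theorem traceSnd_conjTranspose_kronecker_mul [DecidableEq n'] (M : Matrix (n × n') (n × n') ℂ)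
    (U : Matrix n n ℂ) {V : Matrix n' n' ℂ} (hV : V ∈ Matrix.unitaryGroup n' ℂ) :
    traceSnd ((U ⊗ₖ V)ᴴ * M * (U ⊗ₖ V)) = Uᴴ * traceSnd M * U := by
  classical
  have hVV : ((1 : Matrix n n ℂ) ⊗ₖ V) * ((1 : Matrix n n ℂ) ⊗ₖ Vᴴ) = 1 := by
    rw [← Matrix.mul_kronecker_mul, ← Matrix.star_eq_conjTranspose,
      Matrix.mem_unitaryGroup_iff.1 hV, mul_one, Matrix.one_kronecker_one]
  have hUV : U ⊗ₖ V = (U ⊗ₖ (1 : Matrix n' n' ℂ)) * ((1 : Matrix n n ℂ) ⊗ₖ V) := by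
    rw [← Matrix.mul_kronecker_mul, one_mul, mul_one]
  have hUV' : (U ⊗ₖ V)ᴴ = ((1 : Matrix n n ℂ) ⊗ₖ Vᴴ) * (Uᴴ ⊗ₖ (1 : Matrix n' n' ℂ)) := by
    rw [Matrix.conjTranspose_kronecker, ← Matrix.mul_kronecker_mul, one_mul, mul_one]
  rw [hUV', hUV, mul_assoc, mul_assoc, traceSnd_one_kronecker_mul_comm]
  simp only [mul_assoc, hVV, mul_one]
  rw [traceSnd_kronecker_one_mul, traceSnd_mul_kronecker_one]

theorem traceFst_conjTranspose_kronecker_mul [DecidableEq n] (M : Matrix (n × n') (n × n') ℂ)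
    {U : Matrix n n ℂ} (hU : U ∈ Matrix.unitaryGroup n ℂ) (V : Matrix n' n' ℂ) :
    traceFst ((U ⊗ₖ V)ᴴ * M * (U ⊗ₖ V)) = Vᴴ * traceFst M * V := by
  simp only [traceFst_eq_traceSnd_submatrix_swap, submatrix_swap_mul, submatrix_swap_kronecker,
    Matrix.conjTranspose_kronecker, ← traceSnd_conjTranspose_kronecker_mul _ V hU]

end PartialTrace

section TensorMap

variable {m n m' n' : Type*} {Φ : Matrix m m ℂ →ₗ[ℂ] Matrix n n ℂ}
  {Ω : Matrix m' m' ℂ →ₗ[ℂ] Matrix n' n' ℂ}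

theorem traceSnd_tensorMap [Fintype m'] [Fintype n'] (hΩ : ∀ B, (Ω B).trace = B.trace)
    (A : Matrix (m × m') (m × m') ℂ) :
    traceSnd (tensorMap Φ Ω A) = Φ (traceSnd A) := by
  calc traceSnd (tensorMap Φ Ω A)
      = Φ (∑ x, Matrix.of fun i j => Ω (Matrix.of fun k l => A (i, k) (j, l)) x x) := by
        rw [map_sum]; rfl
    _ = Φ (Matrix.of fun i j => (Ω (Matrix.of fun k l => A (i, k) (j, l))).trace) := by
        congr 1; ext i j; simp [Matrix.sum_apply, Matrix.trace]
    _ = Φ (traceSnd A) := by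
        simp only [hΩ]
        congr 1; ext i j; simp [Matrix.sum_apply, Matrix.trace, traceSnd_apply]

end TensorMap

section Subadditivity

variable {n n' : Type*} [Fintype n] [DecidableEq n] [Fintype n'] [DecidableEq n']

theorem conjTranspose_eigenvectorUnitary_mul_mul {A : Matrix n n ℂ} (hA : A.IsHermitian) :
    (hA.eigenvectorUnitary : Matrix n n ℂ)ᴴ * A * hA.eigenvectorUnitary =
      Matrix.diagonal (fun i => (hA.eigenvalues i : ℂ)) := by
  have h := hA.conjStarAlgAut_star_eigenvectorUnitary
  rwa [Unitary.conjStarAlgAut_apply, Unitary.coe_star, star_star] at h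

theorem IsDensityMatrix.sum_eigenvalues {ρ : Matrix n n ℂ} (hρ : IsDensityMatrix ρ) :
    ∑ i, hρ.posSemidef.isHermitian.eigenvalues i = 1 := by
  have h := hρ.posSemidef.isHermitian.trace_eq_sum_eigenvalues
  rw [hρ.trace_eq_one] at h
  exact Complex.ofReal_injective (by simpa using h.symm)

theorem vonNeumannEntropy_le_traceSnd_add_traceFst {A : Matrix (n × n') (n × n') ℂ}
    (hA : IsDensityMatrix A) :
    vonNeumannEntropy A ≤ vonNeumannEntropy (traceSnd A) + vonNeumannEntropy (traceFst A) := by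
  have hL := hA.traceSnd.posSemidef.isHermitian
  have hR := hA.traceFst.posSemidef.isHermitian
  set U : Matrix n n ℂ := ↑hL.eigenvectorUnitary
  set V : Matrix n' n' ℂ := ↑hR.eigenvectorUnitary
  have hUV : U ⊗ₖ V ∈ Matrix.unitaryGroup (n × n') ℂ :=
    Matrix.kronecker_mem_unitary hL.eigenvectorUnitary.2 hR.eigenvectorUnitary.2
  set B := (U ⊗ₖ V)ᴴ * A * (U ⊗ₖ V) with hB
  have hBpos : B.PosSemidef := hA.posSemidef.conjTranspose_mul_mul_same _
  have hsumSnd : ∀ i, ∑ k, (B (i, k) (i, k)).re = hL.eigenvalues i := fun i => by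
    have h : traceSnd B i i = hL.eigenvalues i := by
      rw [hB, traceSnd_conjTranspose_kronecker_mul A U hR.eigenvectorUnitary.2,
        conjTranspose_eigenvectorUnitary_mul_mul hL, Matrix.diagonal_apply_eq]
    simpa [traceSnd_apply, Matrix.sum_apply] using congrArg Complex.re h
  have hsumFst : ∀ k, ∑ i, (B (i, k) (i, k)).re = hR.eigenvalues k := fun k => by
    have h : traceFst B k k = hR.eigenvalues k := by
      rw [hB, traceFst_conjTranspose_kronecker_mul A hL.eigenvectorUnitary.2 V,
        conjTranspose_eigenvectorUnitary_mul_mul hR, Matrix.diagonal_apply_eq]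
    simpa [traceFst_eq_traceSnd_submatrix_swap, traceSnd_apply, Matrix.sum_apply] using
      congrArg Complex.re h
  have hsum : ∑ x, (B x x).re = 1 := by
    simpa only [Fintype.sum_prod_type, hsumSnd] using hA.traceSnd.sum_eigenvalues
  have hnonneg : ∀ x, 0 ≤ (B x x).re := fun x => (Complex.nonneg_iff.1 hBpos.diag_nonneg).1
  calc vonNeumannEntropy A ≤ ∑ x, ((B x x).re).negMulLog := by
        rw [vonNeumannEntropy_eq_sum_negMulLog hA.posSemidef.isHermitian]
        exact sum_eigenvalues_le_sum_diag Real.concaveOn_negMulLog _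
          hA.posSemidef.eigenvalues_nonneg hUV
    _ ≤ ∑ i, (hL.eigenvalues i).negMulLog + ∑ k, (hR.eigenvalues k).negMulLog := by
        simpa only [hsumSnd, hsumFst] using sum_negMulLog_le_add hnonneg hsum
    _ = vonNeumannEntropy (traceSnd A) + vonNeumannEntropy (traceFst A) := by
        rw [vonNeumannEntropy_eq_sum_negMulLog hL, vonNeumannEntropy_eq_sum_negMulLog hR]

end Subadditivity

section Separable

open scoped Matrix.Norms.L2Operator MatrixOrder

variable {n n' : Type*} [Fintype n] [Fintype n']

theorem trace_mul_re_le {R A B : Matrix n n ℂ} (hR : R.PosSemidef) (hAB : A ≤ B) :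
    (R * A).trace.re ≤ (R * B).trace.re := by
  classical
  obtain ⟨C, rfl⟩ := CStarAlgebra.nonneg_iff_eq_star_mul_self.mp hR.nonneg
  have h : 0 ≤ (C * (B - A) * Cᴴ).trace :=
    ((Matrix.le_iff.mp hAB).mul_mul_conjTranspose_same C).trace_nonneg
  rw [Matrix.trace_mul_comm, ← mul_assoc, mul_sub, Matrix.trace_sub, sub_nonneg] at h
  exact (Complex.le_def.mp h).1

theorem submatrix_cfc_le [DecidableEq n] [DecidableEq n'] {f : ℝ → ℝ}
    (hf : ConcaveOn ℝ {A : Matrix n n ℂ | IsStrictlyPositive A} (cfc f)) {X : Matrix n n ℂ}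
    (hX : X.PosDef) {e : n' → n} (he : Function.Injective e) :
    (cfc f X).submatrix e e ≤ cfc f (X.submatrix e e) := by
  have hcompress : ∀ M : Matrix n n ℂ, ((1 : Matrix n n ℂ).submatrix id e)ᴴ * M *
      (1 : Matrix n n ℂ).submatrix id e = M.submatrix e e := fun M => by
    rw [Matrix.conjTranspose_submatrix, Matrix.conjTranspose_one, ← Matrix.submatrix_id_id M,
      ← Matrix.submatrix_mul _ _ e id id Function.bijective_id, Matrix.one_mul,
      ← Matrix.submatrix_mul _ _ e id e Function.bijective_id, Matrix.mul_one,
      Matrix.submatrix_id_id]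
  have hV : ((1 : Matrix n n ℂ).submatrix id e)ᴴ * (1 : Matrix n n ℂ).submatrix id e = 1 := by
    simpa only [Matrix.mul_one, Matrix.submatrix_one e he] using hcompress 1
  simpa only [hcompress] using conjTranspose_mul_cfc_mul_le hf hX hV

variable [DecidableEq n']

theorem trace_kronecker_diagonal_mul (R : Matrix n n ℂ) (s : n' → ℂ)
    (M : Matrix (n × n') (n × n') ℂ) : ((R ⊗ₖ Matrix.diagonal s) * M).trace =
      ∑ k, s k * (R * M.submatrix (fun i => (i, k)) fun i => (i, k)).trace := by
  simp only [Matrix.trace, Matrix.diag_apply, Matrix.mul_apply, Fintype.sum_prod_type_right,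
    Matrix.kroneckerMap_apply, Matrix.diagonal_apply, Matrix.submatrix_apply, Finset.mul_sum,
    mul_ite, ite_mul, mul_zero, zero_mul, Finset.sum_ite_irrel, Finset.sum_const_zero,
    Finset.sum_ite_eq, Finset.mem_univ, if_true]
  refine Finset.sum_congr rfl fun k _ => Finset.sum_congr rfl fun i _ =>
    Finset.sum_congr rfl fun j _ => by ring

variable [DecidableEq n]

theorem trace_kronecker_diagonal_mul_log_add_le {ρ : Matrix (n × n') (n × n') ℂ} (hρ : ρ.PosDef)
    {R : Matrix n n ℂ} (hR : IsDensityMatrix R) {s : n' → ℝ} (hs : ∀ k, 0 ≤ s k)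
    (hsum : ∑ k, s k = 1) :
    ((R ⊗ₖ Matrix.diagonal fun k => (s k : ℂ)) * CFC.log ρ).trace.re + ∑ k, (s k).negMulLog ≤
      (R * CFC.log (traceSnd ρ)).trace.re := by
  let X : n' → Matrix n n ℂ := fun k => ρ.submatrix (fun i => (i, k)) fun i => (i, k)
  have hinj : ∀ k : n', Function.Injective fun i : n => (i, k) := fun k _ _ h =>
    congrArg Prod.fst h
  have hlog : ConcaveOn ℝ {A : Matrix (n × n') (n × n') ℂ | IsStrictlyPositive A} (cfc Real.log) :=
    CFC.concaveOn_log
  have hblock : ∀ k, (CFC.log ρ).submatrix (fun i => (i, k)) (fun i => (i, k)) ≤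
      CFC.log (X k) := fun k => submatrix_cfc_le hlog hρ (hinj k)
  have hlogsum : ∑ k, s k • CFC.log (X k) + algebraMap ℝ (Matrix n n ℂ) (∑ k, (s k).negMulLog) ≤
      CFC.log (traceSnd ρ) := by
    rw [traceSnd_apply]
    exact sum_smul_log_add_le hs hsum fun k => (hρ.submatrix (hinj k)).isStrictlyPositive
  calc ((R ⊗ₖ Matrix.diagonal fun k => (s k : ℂ)) * CFC.log ρ).trace.re + ∑ k, (s k).negMulLog
      = ∑ k, s k * (R * (CFC.log ρ).submatrix (fun i => (i, k)) fun i => (i, k)).trace.re +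
          ∑ k, (s k).negMulLog := by
        simp only [trace_kronecker_diagonal_mul, Complex.re_sum, Complex.re_ofReal_mul]
    _ ≤ ∑ k, s k * (R * CFC.log (X k)).trace.re + ∑ k, (s k).negMulLog :=
        add_le_add_left (Finset.sum_le_sum fun k _ => mul_le_mul_of_nonneg_left
          (trace_mul_re_le hR.posSemidef (hblock k)) (hs k)) _
    _ = (R * (∑ k, s k • CFC.log (X k) +
          algebraMap ℝ (Matrix n n ℂ) (∑ k, (s k).negMulLog))).trace.re := by
        simp only [mul_add, Finset.mul_sum, mul_smul_comm, Matrix.trace_add, Matrix.trace_sum,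
          Matrix.trace_smul, Algebra.algebraMap_eq_smul_one, mul_one, hR.trace_eq_one,
          Complex.add_re, Complex.re_sum, Complex.smul_re, Complex.one_re, smul_eq_mul]
    _ ≤ (R * CFC.log (traceSnd ρ)).trace.re := trace_mul_re_le hR.posSemidef hlogsum

theorem trace_kronecker_mul_log_add_le {ρ : Matrix (n × n') (n × n') ℂ} (hρ : ρ.PosDef)
    {R : Matrix n n ℂ} (hR : IsDensityMatrix R) {σ : Matrix n' n' ℂ} (hσ : IsDensityMatrix σ) :
    ((R ⊗ₖ σ) * CFC.log ρ).trace.re + vonNeumannEntropy σ ≤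
      (R * CFC.log (traceSnd ρ)).trace.re := by
  have hσH := hσ.posSemidef.isHermitian
  set V : Matrix n' n' ℂ := ↑hσH.eigenvectorUnitary
  set D : Matrix n' n' ℂ := Matrix.diagonal fun k => (hσH.eigenvalues k : ℂ)
  have hσV : σ = V * D * Vᴴ := by
    conv_lhs => rw [hσH.spectral_theorem, Unitary.conjStarAlgAut_apply]
    rfl
  set W : Matrix (n × n') (n × n') ℂ := 1 ⊗ₖ V with hW
  have hWunitary : W ∈ Matrix.unitaryGroup (n × n') ℂ :=
    Matrix.kronecker_mem_unitary (one_mem _) hσH.eigenvectorUnitary.2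
  have hWW : W * Wᴴ = 1 := Matrix.mem_unitaryGroup_iff.1 hWunitary
  have hρ' : (Wᴴ * ρ * W).PosDef := hρ.conjTranspose_mul_mul_same
    (Matrix.mulVec_injective_of_isUnit (IsUnit.of_mul_eq_one _ hWW))
  have hlog : CFC.log ρ * W = W * CFC.log (Wᴴ * ρ * W) :=
    cfc_mul_eq_mul_cfc hρ.isHermitian hρ'.isHermitian
      (by rw [mul_assoc, ← mul_assoc W, hWW, one_mul]) _
  have htraceSnd : traceSnd (Wᴴ * ρ * W) = traceSnd ρ := by
    rw [traceSnd_conjTranspose_kronecker_mul ρ 1 hσH.eigenvectorUnitary.2,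
      Matrix.conjTranspose_one, one_mul, mul_one]
  have hkron : R ⊗ₖ σ = W * (R ⊗ₖ D) * Wᴴ := by
    rw [hW, Matrix.conjTranspose_kronecker, ← Matrix.mul_kronecker_mul,
      ← Matrix.mul_kronecker_mul, Matrix.conjTranspose_one, one_mul, mul_one, ← hσV]
  have htrace : ((R ⊗ₖ σ) * CFC.log ρ).trace =
      ((R ⊗ₖ D) * CFC.log (Wᴴ * ρ * W)).trace := by
    rw [hkron, mul_assoc, mul_assoc, Matrix.trace_mul_comm, mul_assoc, mul_assoc, hlog,
      ← mul_assoc Wᴴ, mul_eq_one_comm.1 hWW, one_mul]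
  rw [htrace, vonNeumannEntropy_eq_sum_negMulLog hσH, ← htraceSnd]
  exact trace_kronecker_diagonal_mul_log_add_le hρ' hR hσ.posSemidef.eigenvalues_nonneg
    hσ.sum_eigenvalues

end Separable

section SeparableEntropy

open scoped Matrix.Norms.L2Operator

variable {ι n n' : Type*} [Fintype ι] [Fintype n] [DecidableEq n] [Fintype n'] [DecidableEq n']
  {t : ι → ℝ} {R : ι → Matrix n n ℂ} {σ : ι → Matrix n' n' ℂ}

theorem trace_sum_kronecker_mul_log_add_le (ht : ∀ k, 0 ≤ t k) (hR : ∀ k, IsDensityMatrix (R k))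
    (hσ : ∀ k, IsDensityMatrix (σ k)) {ρ : Matrix (n × n') (n × n') ℂ} (hρ : ρ.PosDef) :
    ((∑ k, (t k : ℂ) • (R k ⊗ₖ σ k)) * CFC.log ρ).trace.re +
        ∑ k, t k * vonNeumannEntropy (σ k) ≤
      ((∑ k, (t k : ℂ) • R k) * CFC.log (traceSnd ρ)).trace.re := by
  simp only [Matrix.sum_mul, Matrix.trace_sum, Matrix.smul_mul, Matrix.trace_smul, Complex.re_sum,
    smul_eq_mul, Complex.re_ofReal_mul, ← Finset.sum_add_distrib, ← mul_add]
  exact Finset.sum_le_sum fun k _ => mul_le_mul_of_nonneg_left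
    (trace_kronecker_mul_log_add_le hρ (hR k) (hσ k)) (ht k)

theorem vonNeumannEntropy_sum_smul_add_le (ht : ∀ k, 0 ≤ t k) (hR : ∀ k, IsDensityMatrix (R k))
    (hσ : ∀ k, IsDensityMatrix (σ k)) :
    vonNeumannEntropy (∑ k, (t k : ℂ) • R k) + ∑ k, t k * vonNeumannEntropy (σ k) ≤
      vonNeumannEntropy (∑ k, (t k : ℂ) • (R k ⊗ₖ σ k)) := by
  set ω := ∑ k, (t k : ℂ) • (R k ⊗ₖ σ k) with hω
  set A := ∑ k, (t k : ℂ) • R k with hA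
  have ht' : ∀ k, (0 : ℂ) ≤ t k := fun k => Complex.zero_le_real.2 (ht k)
  have hωpos : ω.PosSemidef := Matrix.posSemidef_sum _ fun k _ =>
    ((hR k).kronecker (hσ k)).posSemidef.smul (ht' k)
  have hApos : A.PosSemidef := Matrix.posSemidef_sum _ fun k _ => (hR k).posSemidef.smul (ht' k)
  have htraceSnd : ∀ ε : ℝ, traceSnd (ω + ε • 1) = A + (Fintype.card n' * ε) • 1 := fun ε => by
    have hmarginal : traceSnd ω = A := by
      simp only [hω, hA, map_sum, map_smul, traceSnd_kronecker, (hσ _).trace_eq_one, one_smul]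
    rw [map_add, hmarginal, ← Matrix.one_kronecker_one, traceSnd.map_smul_of_tower,
      traceSnd_kronecker, Matrix.trace_one, mul_comm, mul_smul, Nat.cast_smul_eq_nsmul,
      Nat.cast_smul_eq_nsmul]
  have hlim : Filter.Tendsto (fun ε : ℝ => (A * CFC.log (A + (Fintype.card n' * ε) •
      (1 : Matrix n n ℂ))).trace.re) (nhds 0) (nhds (-vonNeumannEntropy A)) := by
    refine (tendsto_trace_mul_log_add_smul_one hApos.isHermitian).comp ?_
    exact Continuous.tendsto' (by fun_prop) _ _ (mul_zero _)
  have hle : ∀ ε > (0 : ℝ), (ω * CFC.log (ω + ε • (1 : Matrix (n × n') (n × n') ℂ))).trace.re +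
      ∑ k, t k * vonNeumannEntropy (σ k) ≤
        (A * CFC.log (A + (Fintype.card n' * ε) • (1 : Matrix n n ℂ))).trace.re := fun ε hε => by
    have hpos : (ω + ε • (1 : Matrix (n × n') (n × n') ℂ)).PosDef :=
      Matrix.PosDef.posSemidef_add hωpos (Matrix.PosDef.one.smul hε)
    rw [← htraceSnd]
    exact trace_sum_kronecker_mul_log_add_le ht hR hσ hpos
  have hmono : nhdsWithin (0 : ℝ) (Set.Ioi 0) ≤ nhds 0 := nhdsWithin_le_nhds
  have h := le_of_tendsto_of_tendsto
    (((tendsto_trace_mul_log_add_smul_one hωpos.isHermitian).mono_left hmono).add_const _)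
    (hlim.mono_left hmono) (Filter.eventually_of_mem self_mem_nhdsWithin hle)
  linarith

theorem vonNeumannEntropy_kronecker {ρ : Matrix n n ℂ} {τ : Matrix n' n' ℂ}
    (hρ : IsDensityMatrix ρ) (hτ : IsDensityMatrix τ) :
    vonNeumannEntropy (ρ ⊗ₖ τ) = vonNeumannEntropy ρ + vonNeumannEntropy τ := by
  apply le_antisymm
  · simpa only [traceSnd_kronecker, traceFst_kronecker, hρ.trace_eq_one, hτ.trace_eq_one,
      one_smul] using vonNeumannEntropy_le_traceSnd_add_traceFst (hρ.kronecker hτ)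
  · simpa using vonNeumannEntropy_sum_smul_add_le (t := fun _ : Unit => 1) (fun _ => zero_le_one)
      (fun _ => hρ) fun _ => hτ

end SeparableEntropy

section MeasurePrepare

variable {m n m' n' : Type*} [Fintype m] [Fintype m']

theorem traceFst_kronecker_one_mul [DecidableEq m'] (X : Matrix m m ℂ)
    (ρ : Matrix (m × m') (m × m') ℂ) :
    traceFst ((X ⊗ₖ (1 : Matrix m' m' ℂ)) * ρ) =
      ∑ i, ∑ j, X i j • Matrix.of fun k l => ρ (j, k) (i, l) := by
  ext k l
  simp [traceFst_eq_traceSnd_submatrix_swap, traceSnd_apply, Matrix.sum_apply, Matrix.mul_apply,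
    Fintype.sum_prod_type, Matrix.one_apply, -Matrix.smul_of]

theorem posSemidef_traceFst_kronecker_one_mul [DecidableEq m'] {X : Matrix m m ℂ}
    (hX : X.PosSemidef) {ρ : Matrix (m × m') (m × m') ℂ} (hρ : ρ.PosSemidef) :
    (traceFst ((X ⊗ₖ (1 : Matrix m' m' ℂ)) * ρ)).PosSemidef := by
  obtain ⟨B, rfl⟩ : ∃ B, X = Bᴴ * B := by
    classical
    open scoped MatrixOrder in
    exact CStarAlgebra.nonneg_iff_eq_star_mul_self.mp hX.nonneg
  have hcyclic : traceFst (((Bᴴ * B) ⊗ₖ (1 : Matrix m' m' ℂ)) * ρ) =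
      traceFst ((B ⊗ₖ (1 : Matrix m' m' ℂ)) * ρ * (B ⊗ₖ (1 : Matrix m' m' ℂ))ᴴ) := by
    rw [Matrix.conjTranspose_kronecker, Matrix.conjTranspose_one,
      ← traceFst_kronecker_one_mul_comm, ← Matrix.mul_assoc, ← Matrix.mul_kronecker_mul,
      Matrix.one_mul]
  rw [hcyclic]
  exact traceFst_posSemidef (hρ.mul_mul_conjTranspose_same _)

theorem tensorMap_eq_sum_kronecker [DecidableEq m'] {ι : Type*} [Fintype ι]
    {Φ : Matrix m m ℂ →ₗ[ℂ] Matrix n n ℂ} {R : ι → Matrix n n ℂ} {X : ι → Matrix m m ℂ}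
    (hΦ : ∀ ρ, Φ ρ = ∑ k, (X k * ρ).trace • R k) (Ω : Matrix m' m' ℂ →ₗ[ℂ] Matrix n' n' ℂ)
    (ρ : Matrix (m × m') (m × m') ℂ) :
    tensorMap Φ Ω ρ = ∑ k, R k ⊗ₖ Ω (traceFst ((X k ⊗ₖ (1 : Matrix m' m' ℂ)) * ρ)) := by
  ext p q
  calc tensorMap Φ Ω ρ p q
      = ∑ k, (X k * Matrix.of fun i j => Ω (Matrix.of fun x y => ρ (i, x) (j, y)) p.2 q.2).trace *
          R k p.1 q.1 := by
        change Φ (Matrix.of fun i j => Ω (Matrix.of fun x y => ρ (i, x) (j, y)) p.2 q.2) p.1 q.1 = _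
        simp only [hΦ, Matrix.sum_apply, Matrix.smul_apply, smul_eq_mul]
    _ = _ := by
        simp only [traceFst_kronecker_one_mul, map_sum, map_smul, Matrix.sum_apply,
          Matrix.kroneckerMap_apply, Matrix.smul_apply, smul_eq_mul, Matrix.trace,
          Matrix.diag_apply, Matrix.mul_apply, Matrix.of_apply, mul_comm (R _ _ _)]

theorem exists_isDensityMatrix_eq_smul [Nonempty m] {A : Matrix m m ℂ} (hA : A.PosSemidef) :
    ∃ ρ, IsDensityMatrix ρ ∧ A = (A.trace.re : ℂ) • ρ := by
  classical
  have htrace : (A.trace.re : ℂ) = A.trace := (Complex.eq_re_of_ofReal_le hA.trace_nonneg).symm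
  rw [htrace]
  by_cases h : A.trace = 0
  · obtain ⟨i⟩ := ‹Nonempty m›
    refine ⟨Matrix.diagonal (Pi.single i 1),
      ⟨Matrix.PosSemidef.diagonal (Pi.single_nonneg.2 zero_le_one), by simp [Matrix.trace]⟩, ?_⟩
    rw [h, zero_smul, hA.trace_eq_zero_iff.1 h]
  · refine ⟨A.trace⁻¹ • A, ⟨hA.smul (inv_nonneg.2 hA.trace_nonneg), ?_⟩, ?_⟩
    · rw [Matrix.trace_smul, smul_eq_mul, inv_mul_cancel₀ h]
    · rw [smul_smul, mul_inv_cancel₀ h, one_smul]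

variable [DecidableEq m] [Fintype n] [Nonempty m'] {Φ : Matrix m m ℂ →ₗ[ℂ] Matrix n n ℂ}
  {ρ : Matrix (m × m') (m × m') ℂ}

theorem IsEntanglementBreaking.exists_tensorMap_eq_sum_smul (hΦ : IsEntanglementBreaking Φ)
    (Ω : Matrix m' m' ℂ →ₗ[ℂ] Matrix n' n' ℂ) (hρ : IsDensityMatrix ρ) :
    ∃ (K : ℕ) (t : Fin K → ℝ) (R : Fin K → Matrix n n ℂ) (τ : Fin K → Matrix m' m' ℂ),
      (∀ k, 0 ≤ t k) ∧ ∑ k, t k = 1 ∧ (∀ k, IsDensityMatrix (R k)) ∧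
      (∀ k, IsDensityMatrix (τ k)) ∧ tensorMap Φ Ω ρ = ∑ k, (t k : ℂ) • (R k ⊗ₖ Ω (τ k)) := by
  classical
  obtain ⟨K, R, X, hR, hX, hXsum, hΦ⟩ := hΦ
  let A : Fin K → Matrix m' m' ℂ := fun k => traceFst ((X k ⊗ₖ (1 : Matrix m' m' ℂ)) * ρ)
  have hA : ∀ k, (A k).PosSemidef := fun k =>
    posSemidef_traceFst_kronecker_one_mul (hX k) hρ.posSemidef
  have hAsum : ∑ k, A k = traceFst ρ := by
    rw [← map_sum, ← Matrix.sum_mul, ← sum_kronecker, hXsum, Matrix.one_kronecker_one,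
      one_mul]
  choose τ hτ hAτ using fun k => exists_isDensityMatrix_eq_smul (hA k)
  refine ⟨K, fun k => (A k).trace.re, R, τ,
    fun k => (Complex.nonneg_iff.1 (hA k).trace_nonneg).1, ?_, hR, hτ, ?_⟩
  · rw [← Complex.re_sum, ← Matrix.trace_sum, hAsum, hρ.traceFst.trace_eq_one, Complex.one_re]
  · rw [tensorMap_eq_sum_kronecker hΦ]
    refine Finset.sum_congr rfl fun k _ => ?_
    rw [← Matrix.kronecker_smul, ← map_smul, ← hAτ k]

variable [DecidableEq n] [Fintype n'] [DecidableEq n'] {Ω : Matrix m' m' ℂ →ₗ[ℂ] Matrix n' n' ℂ}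

theorem IsEntanglementBreaking.exists_ensemble_add_le (hΦ : IsEntanglementBreaking Φ)
    (hΩ : IsChannel Ω) (hρ : IsDensityMatrix ρ) :
    ∃ (K : ℕ) (t : Fin K → ℝ) (τ : Fin K → Matrix m' m' ℂ),
      (∀ k, 0 ≤ t k) ∧ ∑ k, t k = 1 ∧ (∀ k, IsDensityMatrix (τ k)) ∧
      traceFst (tensorMap Φ Ω ρ) = Ω (∑ k, (t k : ℂ) • τ k) ∧
      vonNeumannEntropy (Φ (traceSnd ρ)) + ∑ k, t k * vonNeumannEntropy (Ω (τ k)) ≤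
        vonNeumannEntropy (tensorMap Φ Ω ρ) := by
  obtain ⟨K, t, R, τ, ht, htsum, hR, hτ, hout⟩ := hΦ.exists_tensorMap_eq_sum_smul Ω hρ
  have hΩτ : ∀ k, IsDensityMatrix (Ω (τ k)) := fun k => hΩ.map_isDensityMatrix (hτ k)
  refine ⟨K, t, τ, ht, htsum, hτ, ?_, ?_⟩
  · simp only [hout, map_sum, map_smul, traceFst_kronecker, (hR _).trace_eq_one, one_smul]
  · have hmarginal : Φ (traceSnd ρ) = ∑ k, (t k : ℂ) • R k := by
      simp only [← traceSnd_tensorMap hΩ.trace_map, hout, map_sum, map_smul, traceSnd_kronecker,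
        (hΩτ _).trace_eq_one, one_smul]
    rw [hmarginal, hout]
    exact vonNeumannEntropy_sum_smul_add_le ht hR hΩτ

end MeasurePrepare

section Holevo

variable {m n m' n' : Type*} [Fintype m] [Fintype n] [DecidableEq n] [Fintype m'] [Fintype n']
  [DecidableEq n'] {Φ : Matrix m m ℂ →ₗ[ℂ] Matrix n n ℂ} {Ω : Matrix m' m' ℂ →ₗ[ℂ] Matrix n' n' ℂ}

theorem mem_holevoQuantities {ι : Type*} [Fintype ι] {p : ι → ℝ} {ρ : ι → Matrix m m ℂ}
    (hp : ∀ k, 0 ≤ p k) (hsum : ∑ k, p k = 1) (hρ : ∀ k, IsDensityMatrix (ρ k)) :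
    vonNeumannEntropy (Φ (∑ k, (p k : ℂ) • ρ k)) - ∑ k, p k * vonNeumannEntropy (Φ (ρ k)) ∈
      holevoQuantities Φ := by
  let e := (Fintype.equivFin ι).symm
  refine ⟨Fintype.card ι, p ∘ e, ρ ∘ e, fun k => hp _, ?_, fun k => hρ _, ?_⟩
  · rw [← hsum]
    exact e.sum_comp p
  · rw [← e.sum_comp, ← e.sum_comp fun k => p k * vonNeumannEntropy (Φ (ρ k))]
    rfl

theorem add_mem_holevoQuantities_tensorMap (hΦ : IsChannel Φ) (hΩ : IsChannel Ω) {x y : ℝ}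
    (hx : x ∈ holevoQuantities Φ) (hy : y ∈ holevoQuantities Ω) :
    x + y ∈ holevoQuantities (tensorMap Φ Ω) := by
  obtain ⟨K, p, ρ, hp, hpsum, hρ, rfl⟩ := hx
  obtain ⟨L, q, σ, hq, hqsum, hσ, rfl⟩ := hy
  let r : Fin K × Fin L → ℝ := fun k => p k.1 * q k.2
  have hr : ∀ k, 0 ≤ r k := fun k => mul_nonneg (hp _) (hq _)
  have hrsum : ∑ k, r k = 1 := by
    rw [Fintype.sum_prod_type, ← Finset.sum_mul_sum, hpsum, hqsum, one_mul]
  have haverage : ∑ k, (r k : ℂ) • (ρ k.1 ⊗ₖ σ k.2) =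
      (∑ k, (p k : ℂ) • ρ k) ⊗ₖ (∑ l, (q l : ℂ) • σ l) := by
    simp only [r, sum_kronecker, Matrix.smul_kronecker]
    simp only [Fintype.sum_prod_type, kronecker_sum, Matrix.kronecker_smul, smul_smul,
      Complex.ofReal_mul, Finset.smul_sum]
  have hentropy : ∑ k, r k * vonNeumannEntropy (tensorMap Φ Ω (ρ k.1 ⊗ₖ σ k.2)) =
      ∑ k, p k * vonNeumannEntropy (Φ (ρ k)) + ∑ l, q l * vonNeumannEntropy (Ω (σ l)) := by
    have hterm : ∀ k, r k * vonNeumannEntropy (tensorMap Φ Ω (ρ k.1 ⊗ₖ σ k.2)) =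
        (p k.1 * vonNeumannEntropy (Φ (ρ k.1))) * q k.2 +
          p k.1 * (q k.2 * vonNeumannEntropy (Ω (σ k.2))) := fun k => by
      rw [tensorMap_kronecker, vonNeumannEntropy_kronecker (hΦ.map_isDensityMatrix (hρ _))
        (hΩ.map_isDensityMatrix (hσ _))]
      ring
    simp only [hterm, Finset.sum_add_distrib, Fintype.sum_prod_type, ← Finset.sum_mul_sum, hpsum,
      hqsum, one_mul, mul_one]
  have h := mem_holevoQuantities (Φ := tensorMap Φ Ω) hr hrsum fun k => (hρ k.1).kronecker (hσ k.2)
  rwa [hentropy, haverage, tensorMap_kronecker, vonNeumannEntropy_kronecker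
    (hΦ.map_isDensityMatrix (.sum_smul hp hpsum hρ))
    (hΩ.map_isDensityMatrix (.sum_smul hq hqsum hσ)), add_sub_add_comm] at h

theorem IsEntanglementBreaking.exists_le_add_of_mem_holevoQuantities [DecidableEq m]
    [Nonempty m'] (hΦ : IsEntanglementBreaking Φ) (hΩ : IsChannel Ω) {x : ℝ}
    (hx : x ∈ holevoQuantities (tensorMap Φ Ω)) :
    ∃ y ∈ holevoQuantities Φ, ∃ z ∈ holevoQuantities Ω, x ≤ y + z := by
  obtain ⟨N, p, ρ, hp, hpsum, hρ, rfl⟩ := hx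
  choose K t τ ht htsum hτ hmarginal hle using fun i => hΦ.exists_ensemble_add_le hΩ (hρ i)
  let q : (Σ i, Fin (K i)) → ℝ := fun x => p x.1 * t x.1 x.2
  have hq : ∀ x, 0 ≤ q x := fun x => mul_nonneg (hp _) (ht _ _)
  have hqsum : ∑ x, q x = 1 := by
    simp only [q, Fintype.sum_sigma, ← Finset.mul_sum, htsum, mul_one, hpsum]
  refine ⟨_, mem_holevoQuantities hp hpsum fun i => (hρ i).traceSnd, _,
    mem_holevoQuantities hq hqsum fun x => hτ x.1 x.2, ?_⟩
  have hsubadditive := vonNeumannEntropy_le_traceSnd_add_traceFst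
    ((hΦ.isChannel.tensorMap hΩ).map_isDensityMatrix (.sum_smul hp hpsum hρ))
  have hSnd : traceSnd (tensorMap Φ Ω (∑ i, (p i : ℂ) • ρ i)) =
      Φ (∑ i, (p i : ℂ) • traceSnd (ρ i)) := by
    rw [traceSnd_tensorMap hΩ.trace_map, map_sum]
    simp only [map_smul]
  have hFst : traceFst (tensorMap Φ Ω (∑ i, (p i : ℂ) • ρ i)) =
      Ω (∑ x, (q x : ℂ) • τ x.1 x.2) := by
    simp only [map_sum, map_smul, hmarginal, q, Fintype.sum_sigma, Finset.smul_sum, smul_smul,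
      Complex.ofReal_mul]
  have hmembers : ∑ i, p i * vonNeumannEntropy (Φ (traceSnd (ρ i))) +
      ∑ x, q x * vonNeumannEntropy (Ω (τ x.1 x.2)) ≤
        ∑ i, p i * vonNeumannEntropy (tensorMap Φ Ω (ρ i)) := by
    simp only [q, Fintype.sum_sigma, mul_assoc, ← Finset.mul_sum, ← Finset.sum_add_distrib,
      ← mul_add]
    exact Finset.sum_le_sum fun i _ => mul_le_mul_of_nonneg_left (hle i) (hp i)
  rw [hSnd, hFst] at hsubadditive
  linarith

theorem IsEntanglementBreaking.holevoCapacity_tensorMap_le [DecidableEq m] [Nonempty m]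
    [Nonempty m'] (hΦ : IsEntanglementBreaking Φ) (hΩ : IsChannel Ω) :
    holevoCapacity (tensorMap Φ Ω) ≤ holevoCapacity Φ + holevoCapacity Ω := by
  refine csSup_le (holevoQuantities_nonempty _) fun x hx => ?_
  obtain ⟨y, hy, z, hz, hxyz⟩ := hΦ.exists_le_add_of_mem_holevoQuantities hΩ hx
  exact hxyz.trans (add_le_add (le_csSup (holevoQuantities_bddAbove hΦ.isChannel) hy)
    (le_csSup (holevoQuantities_bddAbove hΩ) hz))

open scoped Pointwise in
theorem IsChannel.holevoCapacity_add_le [Nonempty m] [Nonempty m'] (hΦ : IsChannel Φ)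
    (hΩ : IsChannel Ω) :
    holevoCapacity Φ + holevoCapacity Ω ≤ holevoCapacity (Quantum.tensorMap Φ Ω) := by
  have hneΦ := holevoQuantities_nonempty Φ
  have hneΩ := holevoQuantities_nonempty Ω
  calc holevoCapacity Φ + holevoCapacity Ω
      = sSup (holevoQuantities Φ + holevoQuantities Ω) :=
        (csSup_add hneΦ (holevoQuantities_bddAbove hΦ) hneΩ (holevoQuantities_bddAbove hΩ)).symm
    _ ≤ holevoCapacity (Quantum.tensorMap Φ Ω) := by
        refine csSup_le_csSup (holevoQuantities_bddAbove (hΦ.tensorMap hΩ)) (hneΦ.add hneΩ) ?_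
        rintro _ ⟨x, hx, y, hy, rfl⟩
        exact add_mem_holevoQuantities_tensorMap hΦ hΩ hx hy

end Holevo

end Quantum

end

theorem mainTheorem5 {m n m' n' : Type*}
    [Fintype m] [DecidableEq m] [Nonempty m] [Fintype n] [DecidableEq n]
    [Fintype m'] [DecidableEq m'] [Nonempty m'] [Fintype n'] [DecidableEq n']
    (Φ : Matrix m m ℂ →ₗ[ℂ] Matrix n n ℂ) (hΦ : Quantum.IsEntanglementBreaking Φ)
    (Ω : Matrix m' m' ℂ →ₗ[ℂ] Matrix n' n' ℂ) (hΩ : Quantum.IsChannel Ω) :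
    Quantum.holevoCapacity (Quantum.tensorMap Φ Ω) =
      Quantum.holevoCapacity Φ + Quantum.holevoCapacity Ω :=
  le_antisymm (hΦ.holevoCapacity_tensorMap_le hΩ) (hΦ.isChannel.holevoCapacity_add_le hΩ)
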